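/- Let $\varepsilon\in\{1,0,-1\}$ and let $D\subset\mathbb R^4$ be a connected open set of coordinates $(t,x,y,z)$. Put $r^2=x^2+y^2+z^2$ and $w=\dfrac{2z}{1+\frac{\varepsilon}{4}r^2}$. A *thermodynamic Stephani universe* on $D$ is given by smooth functions $R(t)$, $b(t)$ through the metric $$ds^2=-\alpha^2dt^2+\Omega^2(dx^2+dy^2+dz^2),\qquad \alpha=R\,\partial_R\ln L,\quad \Omega=\frac{w}{2z}L=\frac{L}{1+\frac{\varepsilon}{4}r^2},\quad L=\frac{R}{1+bw},$$ where functions of $t$ are regarded as functions of $R$, so $\partial_R=\dot R^{-1}\partial_t$. It is required that $R$, $\dot R$, $1+\frac{\varepsilon}{4}r^2$, $1+bw$ and $\alpha$ do not vanish on $D$. The fluid has unit velocity $u=\alpha^{-1}\partial_t$, energy density $\rho=\frac{3}{R^2}(\dot R^2+\varepsilon-4b^2)$ and pressure $p=-\rho-\frac{R}{3}\frac{\rho'(R)}{\alpha}$ (units $8\pi G=c=1$). Let $\theta$, $\sigma$ and $a$ be the expansion, shear and acceleration of $u$, and let $\perp$ be the projection orthogonal to $u$. A *thermodynamic scheme*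 is a set of smooth functions $\{n,\epsilon,s,\Theta\}$ on $D$ with $n\neq0$ such that $$u(n)+n\theta=0,\qquad \rho=n(1+\epsilon),\qquad \Theta\,ds=d\epsilon+p\,d(1/n).$$ The universe is *compatible with a non-vanishing shear viscosity* if $\sigma=0$. A scheme is *compatible with a non-vanishing thermal conductivity* if $\Theta\neq0$ and $a=-\perp d\ln|\Theta|$. The universe is *FLRW* if on $D$ its metric has the form $-N(t)^2dt^2+S(t)^2h$, with $h$ a Riemannian metric in the comoving coordinates $(x,y,z)$ that is independent of $t$ and of constant curvature. Then: 1. Every thermodynamic Stephani universe is compatible with a non-vanishing shear viscosity. 2. A thermodynamic Stephani universe with $\rho+p\neq0$ everywhere on $D$ admits a thermodynamic scheme compatible with a non-vanishing thermal conductivity if and only if it is FLRW. 3. Every FLRW thermodynamic Stephani universe (with no condition on $\rho+p$) admits such a scheme with $n>0$ and $\Theta>0$. -/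

import Mathlib

open scoped ContDiff

/-! ### Tensor calculus in one coordinate chart of `ℝⁿ` -/

/-- The partial derivative `∂ᵢ f` at `x`. -/
noncomputable def pd {n : ℕ} (i : Fin n) (f : (Fin n → ℝ) → ℝ) (x : Fin n → ℝ) : ℝ :=
  fderiv ℝ f x (Pi.single i 1)

/-- A metric field on a chart, given by its components `g_{ij}(x)`. -/
abbrev MetricField (n : ℕ) := (Fin n → ℝ) → Matrix (Fin n) (Fin n) ℝ

/-- Christoffel symbols `Γ^l_{ij} = ½ g^{lm} (∂ᵢ g_{mj} + ∂ⱼ g_{mi} - ∂ₘ g_{ij})`. -/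
noncomputable def christoffel {n : ℕ} (g : MetricField n) (l i j : Fin n) (x : Fin n → ℝ) : ℝ :=
  (1 / 2) * ∑ m, (g x)⁻¹ l m *
    (pd i (fun y => g y m j) x + pd j (fun y => g y m i) x - pd m (fun y => g y i j) x)

/-- Curvature tensor `R^l_{kij} = ∂ᵢ Γ^l_{jk} - ∂ⱼ Γ^l_{ik} + Γ^l_{im} Γ^m_{jk} - Γ^l_{jm} Γ^m_{ik}`. -/
noncomputable def riemann {n : ℕ} (g : MetricField n) (l k i j : Fin n) (x : Fin n → ℝ) : ℝ :=
  pd i (christoffel g l j k) x - pd j (christoffel g l i k) x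
    + ∑ m, (christoffel g l i m x * christoffel g m j k x
      - christoffel g l j m x * christoffel g m i k x)

/-- `h` is, on `S`, a Riemannian metric of constant curvature `κ`:
`R^l_{kij} = κ (δ^l_i h_{jk} - δ^l_j h_{ik})`. -/
def HasConstantCurvatureOn {n : ℕ} (h : MetricField n) (S : Set (Fin n → ℝ)) (κ : ℝ) : Prop :=
  ∀ x ∈ S, (h x).PosDef ∧ ∀ l k i j : Fin n,
    riemann h l k i j x =
      κ * ((if l = i then 1 else 0) * h x j k - (if l = j then 1 else 0) * h x i k)

/-! ### Kinematics of a unit timelike vector field, signature `(-,+,+,+)` -/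

/-- A vector field on a chart of spacetime, given by its contravariant components. -/
abbrev VectorField4 := (Fin 4 → ℝ) → Fin 4 → ℝ

/-- Covariant components `u_μ = g_{μν} u^ν`. -/
noncomputable def lower (g : MetricField 4) (u : VectorField4) (μ : Fin 4) (x : Fin 4 → ℝ) : ℝ :=
  ∑ ν, g x μ ν * u x ν

/-- The covariant derivative `∇_μ u_ν = ∂_μ u_ν - Γ^l_{μν} u_l`. -/
noncomputable def covDeriv (g : MetricField 4) (u : VectorField4) (μ ν : Fin 4)
    (x : Fin 4 → ℝ) : ℝ :=
  pd μ (lower g u ν) x - ∑ l, christoffel g l μ ν x * lower g u l x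

/-- The directional derivative `u(q) = u^μ ∂_μ q`. -/
noncomputable def along (u : VectorField4) (q : (Fin 4 → ℝ) → ℝ) (x : Fin 4 → ℝ) : ℝ :=
  ∑ μ, u x μ * pd μ q x

/-- The expansion `θ = ∇ · u = g^{μν} ∇_μ u_ν`. -/
noncomputable def expansion (g : MetricField 4) (u : VectorField4) (x : Fin 4 → ℝ) : ℝ :=
  ∑ μ, ∑ ν, (g x)⁻¹ μ ν * covDeriv g u μ ν x

/-- The acceleration, as a 1-form: `a_ν = u^μ ∇_μ u_ν`. -/
noncomputable def acceleration (g : MetricField 4) (u : VectorField4) (ν : Fin 4)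
    (x : Fin 4 → ℝ) : ℝ :=
  ∑ μ, u x μ * covDeriv g u μ ν x

/-- The projector orthogonal to `u`, with mixed indices: `P^μ_ν = δ^μ_ν + u^μ u_ν`. -/
noncomputable def projector (g : MetricField 4) (u : VectorField4) (μ ν : Fin 4)
    (x : Fin 4 → ℝ) : ℝ :=
  (if μ = ν then 1 else 0) + u x μ * lower g u ν x

/-- The shear: the trace-free symmetric part of the projection of `∇u` orthogonal to `u`. -/
noncomputable def shear (g : MetricField 4) (u : VectorField4) (μ ν : Fin 4)
    (x : Fin 4 → ℝ) : ℝ :=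
  (1 / 2) * ∑ κ, ∑ l, projector g u κ μ x * projector g u l ν x *
      (covDeriv g u κ l x + covDeriv g u l κ x)
    - (1 / 3) * expansion g u x * (g x μ ν + lower g u μ x * lower g u ν x)

/-- The component `μ` of `⊥ df`, the projection of `df` orthogonal to `u`. -/
noncomputable def perpGrad (g : MetricField 4) (u : VectorField4) (f : (Fin 4 → ℝ) → ℝ)
    (μ : Fin 4) (x : Fin 4 → ℝ) : ℝ :=
  ∑ ν, projector g u ν μ x * pd ν f x

/-! ### Thermodynamic schemes and transport coefficients -/

/-- Matter density `n`, specific internal energy `ε`, specific entropy `s`, temperature `Θ`. -/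
structure ThermoQuantities where
  n : (Fin 4 → ℝ) → ℝ
  ε : (Fin 4 → ℝ) → ℝ
  s : (Fin 4 → ℝ) → ℝ
  Θ : (Fin 4 → ℝ) → ℝ

/-- `Q` is a thermodynamic scheme on `D` for the fluid with unit velocity `u`, energy density `ρ`
and pressure `p`: matter conservation, energy decomposition, and the local thermal equilibrium
relation hold. -/
structure IsThermodynamicScheme (D : Set (Fin 4 → ℝ)) (g : MetricField 4) (u : VectorField4)
    (ρ p : (Fin 4 → ℝ) → ℝ) (Q : ThermoQuantities) : Prop where
  smooth_n : ContDiffOn ℝ ∞ Q.n D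
  smooth_ε : ContDiffOn ℝ ∞ Q.ε D
  smooth_s : ContDiffOn ℝ ∞ Q.s D
  smooth_Θ : ContDiffOn ℝ ∞ Q.Θ D
  n_ne_zero : ∀ x ∈ D, Q.n x ≠ 0
  /-- `∇ · (n u) = u(n) + n θ = 0` -/
  matter_conservation : ∀ x ∈ D, along u Q.n x + Q.n x * expansion g u x = 0
  /-- `ρ = n (1 + ε)` -/
  energy_decomposition : ∀ x ∈ D, ρ x = Q.n x * (1 + Q.ε x)
  /-- `Θ ds = dε + p d(1/n)` -/
  first_law : ∀ x ∈ D, ∀ μ,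
    Q.Θ x * pd μ Q.s x = pd μ Q.ε x + p x * pd μ (fun y => 1 / Q.n y) x

/-- The constraint imposed by a non-vanishing thermal conductivity coefficient on an evolution
without heat flux: `a = - ⊥ d ln Θ`, where `Θ ≠ 0`. (`Real.log` is `ln |·|`.) -/
def FourierConstraint (D : Set (Fin 4 → ℝ)) (g : MetricField 4) (u : VectorField4)
    (Θ : (Fin 4 → ℝ) → ℝ) : Prop :=
  ∀ x ∈ D, Θ x ≠ 0 ∧
    ∀ μ, acceleration g u μ x = - perpGrad g u (fun y => Real.log (Θ y)) μ x

/-- The constraint imposed by a non-vanishing shear viscosity coefficient on an evolution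
without viscous stresses: the shear vanishes. -/
def ShearFree (D : Set (Fin 4 → ℝ)) (g : MetricField 4) (u : VectorField4) : Prop :=
  ∀ x ∈ D, ∀ μ ν, shear g u μ ν x = 0

/-! ### FLRW metrics -/

/-- The spatial coordinates of an event. -/
def spatial (x : Fin 4 → ℝ) : Fin 3 → ℝ := fun i => x i.succ

/-- On `D` the metric is, in the given comoving coordinates `(t, x, y, z)`, an FLRW metric
`-N(t)² dt² + S(t)² h`, with `h` a time-independent spatial metric of constant curvature. -/
def IsFLRW (D : Set (Fin 4 → ℝ)) (g : MetricField 4) : Prop :=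
  ∃ (N S : ℝ → ℝ) (h : MetricField 3) (κ : ℝ),
    HasConstantCurvatureOn h (spatial '' D) κ ∧
    ∀ x ∈ D, g x 0 0 = - (N (x 0)) ^ 2 ∧
      ∀ i j : Fin 3, g x 0 i.succ = 0 ∧ g x i.succ 0 = 0 ∧
        g x i.succ j.succ = (S (x 0)) ^ 2 * h (spatial x) i j

/-! ### Thermodynamic Stephani universes -/

/-- The data of a thermodynamic Stephani universe: the symmetry index `ε`, the functions of time
`R(t)` and `b(t)`, and the coordinate domain `D` of `(t, x, y, z)`. -/
structure StephaniData where
  ε : ℝ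
  R : ℝ → ℝ
  b : ℝ → ℝ
  D : Set (Fin 4 → ℝ)

namespace StephaniData

variable (U : StephaniData)

/-- `1 + (ε/4) r²` with `r² = x² + y² + z²`. -/
noncomputable def q (x : Fin 4 → ℝ) : ℝ :=
  1 + U.ε / 4 * (x 1 ^ 2 + x 2 ^ 2 + x 3 ^ 2)

/-- `w = 2 z / (1 + (ε/4) r²)`. -/
noncomputable def w (x : Fin 4 → ℝ) : ℝ := 2 * x 3 / U.q x

/-- `L = R(t) / (1 + b(t) w)`. -/
noncomputable def L (x : Fin 4 → ℝ) : ℝ := U.R (x 0) / (1 + U.b (x 0) * U.w x)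

/-- `Ω = (w / 2z) L`, that is, `L / (1 + (ε/4) r²)`. -/
noncomputable def Ω (x : Fin 4 → ℝ) : ℝ := 1 / U.q x * U.L x

/-- `α = R ∂_R ln L`, where functions of `t` are seen as functions of `R`: `∂_R = (1/Ṙ) ∂_t`. -/
noncomputable def α (x : Fin 4 → ℝ) : ℝ :=
  U.R (x 0) * (pd 0 (fun y => Real.log (U.L y)) x / deriv U.R (x 0))

/-- `ds² = - α² dt² + Ω² (dx² + dy² + dz²)`. -/
noncomputable def metric : MetricField 4 := fun x =>
  Matrix.diagonal ![- (U.α x) ^ 2, (U.Ω x) ^ 2, (U.Ω x) ^ 2, (U.Ω x) ^ 2]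

/-- The fluid unit velocity `u = (1/α) ∂_t`. -/
noncomputable def velocity : VectorField4 := fun x => ![1 / U.α x, 0, 0, 0]

/-- The energy density as a function of time, `ρ = (3/R²) (Ṙ² + ε - 4 b²)`. -/
noncomputable def rhoOfTime (t : ℝ) : ℝ :=
  3 / (U.R t) ^ 2 * ((deriv U.R t) ^ 2 + U.ε - 4 * (U.b t) ^ 2)

/-- The energy density. -/
noncomputable def ρ (x : Fin 4 → ℝ) : ℝ := U.rhoOfTime (x 0)

/-- The pressure `p = - ρ - (R/3) ρ'(R) / α`, with `ρ'(R) = ρ̇ / Ṙ`. -/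
noncomputable def p (x : Fin 4 → ℝ) : ℝ :=
  - U.ρ x - U.R (x 0) / 3 * ((deriv U.rhoOfTime (x 0) / deriv U.R (x 0)) / U.α x)

end StephaniData

/-- `U` is a thermodynamic Stephani universe: `ε ∈ {1, 0, -1}` (spherical, plane or hyperbolic
symmetry), the coordinate domain is open and connected, `R` and `b` are smooth, the fluid expands
or contracts (`Ṙ ≠ 0`), and the metric functions are regular on the domain. -/
structure IsThermodynamicStephani (U : StephaniData) : Prop where
  symmetry : U.ε = 1 ∨ U.ε = 0 ∨ U.ε = -1
  isOpen : IsOpen U.D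
  isConnected : IsConnected U.D
  smooth_R : ∀ x ∈ U.D, ContDiffAt ℝ ∞ U.R (x 0)
  smooth_b : ∀ x ∈ U.D, ContDiffAt ℝ ∞ U.b (x 0)
  R_ne_zero : ∀ x ∈ U.D, U.R (x 0) ≠ 0
  deriv_R_ne_zero : ∀ x ∈ U.D, deriv U.R (x 0) ≠ 0
  q_ne_zero : ∀ x ∈ U.D, U.q x ≠ 0
  one_add_bw_ne_zero : ∀ x ∈ U.D, 1 + U.b (x 0) * U.w x ≠ 0
  α_ne_zero : ∀ x ∈ U.D, U.α x ≠ 0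

namespace StephaniData

/-- `Q` is a thermodynamic scheme of `U`. -/
def HasScheme (U : StephaniData) (Q : ThermoQuantities) : Prop :=
  IsThermodynamicScheme U.D U.metric U.velocity U.ρ U.p Q

/-- `U` is compatible with a non-vanishing shear viscosity coefficient. -/
def ShearViscosityCompatible (U : StephaniData) : Prop :=
  ShearFree U.D U.metric U.velocity

/-- The temperature of `Q` is compatible with a non-vanishing thermal conductivity coefficient. -/
def ThermalConductivityCompatible (U : StephaniData) (Q : ThermoQuantities) : Prop :=
  FourierConstraint U.D U.metric U.velocity Q.Θ

end StephaniData

/-! ### Calculus of partial derivatives -/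

section PartialDerivatives

variable {n : ℕ} {f g : (Fin n → ℝ) → ℝ} {x : Fin n → ℝ} (i : Fin n)

/-! Everything rests on two formulas: `α = 1 - (R ḃ/Ṙ) w/(1 + b w)` and `∂ₜ ln Ω = α Ṙ/R`. The
metric is `-α² dt² + Ω² δ`, whose comoving shear vanishes for any lapse and conformal factor; that
is the first claim.

FLRW is equivalent to `ḃ = 0`. If `α` depends on `t` only, clearing denominators gives a quadratic
in `w` with infinitely many roots, which forces `ḃ = 0` (`deriv_b_eq_zero_of_isFLRW`). Conversely,
for `b = β` one has `α = 1` and `Ω = R/ψ` with `ψ = 1 + (ε/4) r² + 2βz`, and `ψ⁻² δ` has constant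
curvature `ε - 4β²` (`isFLRW_of_deriv_b_eq_zero`). Then `a = 0`, so constant temperature and entropy
with `n ∝ |R|⁻³` form a compatible scheme, whatever `ρ + p` is.

The hard direction is `deriv_b_eq_zero_of_thermalConductivityCompatible`. Along the fluid lines `s`
and `n Ω³` are conserved; the Fourier constraint makes `αΘ` independent of `z`; and `α(ρ + p)`
depends on `t` only. The `z`-component of the first law therefore integrates to `s(z) - C(t) M(z)/(1
+ b(t) w(z))³ = A(t)`, with `C ≠ 0` because `ρ + p ≠ 0`. If `ḃ ≠ 0` somewhere, three nearby times
have distinct non-zero values of `b`. Eliminating `s` and `M` between them leaves a linear relation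
among three functions `(1 + bᵢ w)⁻³`, which are independent; this contradicts `C ≠ 0`
(`not_separated_of_infinite`). -/

theorem pd_congr (h : f =ᶠ[nhds x] g) : pd i f x = pd i g x := by
  simp only [pd, h.fderiv_eq]

theorem pd_const (c : ℝ) : pd i (fun _ => c) x = 0 := by
  simp [pd]

theorem pd_add (hf : DifferentiableAt ℝ f x) (hg : DifferentiableAt ℝ g x) :
    pd i (fun y => f y + g y) x = pd i f x + pd i g x := by
  simp only [pd]
  rw [fderiv_fun_add hf hg]; rfl

theorem pd_sub (hf : DifferentiableAt ℝ f x) (hg : DifferentiableAt ℝ g x) :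
    pd i (fun y => f y - g y) x = pd i f x - pd i g x := by
  simp only [pd]
  rw [fderiv_fun_sub hf hg]; rfl

theorem pd_mul (hf : DifferentiableAt ℝ f x) (hg : DifferentiableAt ℝ g x) :
    pd i (fun y => f y * g y) x = f x * pd i g x + g x * pd i f x := by
  simp only [pd]
  rw [fderiv_fun_mul hf hg]; rfl

theorem pd_const_mul (c : ℝ) (hf : DifferentiableAt ℝ f x) :
    pd i (fun y => c * f y) x = c * pd i f x := by
  rw [pd_mul i (differentiableAt_const c) hf, pd_const]; ring

theorem pd_neg : pd i (fun y => - f y) x = - pd i f x := by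
  simp only [pd]
  rw [fderiv_fun_neg]; rfl

/-- The chain rule for a function of one variable composed with a scalar field. -/
theorem pd_comp {φ : ℝ → ℝ} (hφ : DifferentiableAt ℝ φ (f x)) (hf : DifferentiableAt ℝ f x) :
    pd i (fun y => φ (f y)) x = deriv φ (f x) * pd i f x := by
  have h := (hφ.hasDerivAt.comp_hasFDerivAt x hf.hasFDerivAt).fderiv
  simp only [pd]
  rw [show (fun y => φ (f y)) = φ ∘ f from rfl, h]; rfl

theorem pd_sq (hf : DifferentiableAt ℝ f x) :
    pd i (fun y => f y ^ 2) x = 2 * f x * pd i f x := by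
  simp only [pow_two]
  rw [pd_mul i hf hf]; ring

theorem pd_inv (hf : DifferentiableAt ℝ f x) (h0 : f x ≠ 0) :
    pd i (fun y => (f y)⁻¹) x = - pd i f x / f x ^ 2 := by
  rw [pd_comp i (φ := fun r => r⁻¹) (differentiableAt_inv h0) hf, deriv_inv]
  field_simp

theorem pd_div (hf : DifferentiableAt ℝ f x) (hg : DifferentiableAt ℝ g x) (h0 : g x ≠ 0) :
    pd i (fun y => f y / g y) x = (g x * pd i f x - f x * pd i g x) / g x ^ 2 := by
  simp only [div_eq_mul_inv (f _)]
  rw [pd_mul i hf (g := fun y => (g y)⁻¹) (hg.inv h0), pd_inv i hg h0]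
  field_simp
  ring

theorem pd_log (hf : DifferentiableAt ℝ f x) (h0 : f x ≠ 0) :
    pd i (fun y => Real.log (f y)) x = pd i f x / f x := by
  rw [pd_comp i (Real.differentiableAt_log h0) hf, Real.deriv_log]
  field_simp

theorem pd_coord (j : Fin n) : pd i (fun y => y j) x = if j = i then 1 else 0 := by
  have h : HasFDerivAt (fun y : Fin n → ℝ => y j)
    (ContinuousLinearMap.proj (R := ℝ) (φ := fun _ => ℝ) j) x := hasFDerivAt_apply j x
  simp [pd, h.fderiv, Pi.single_apply]

theorem differentiableAt_coord (j : Fin n) : DifferentiableAt ℝ (fun y : Fin n → ℝ => y j) x :=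
  (hasFDerivAt_apply j x).differentiableAt

theorem pd_comp_coord {φ : ℝ → ℝ} (j : Fin n) (hφ : DifferentiableAt ℝ φ (x j)) :
    pd i (fun y => φ (y j)) x = if j = i then deriv φ (x j) else 0 := by
  rw [pd_comp i hφ (differentiableAt_coord j), pd_coord]
  simp

/-- Restricting a scalar field to a line in the direction of the `i`-th axis. -/
theorem hasDerivAt_comp_of_single {γ : ℝ → Fin n → ℝ} {v : ℝ}
    (hγ : HasDerivAt γ (Pi.single i 1) v) (hf : DifferentiableAt ℝ f (γ v)) :
    HasDerivAt (fun r => f (γ r)) (pd i f (γ v)) v :=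
  hf.hasFDerivAt.comp_hasDerivAt v hγ

end PartialDerivatives

/-! ### Diagonal metrics -/

theorem inv_diagonal_of_ne_zero {n : ℕ} {d : Fin n → ℝ} (hd : ∀ i, d i ≠ 0) :
    (Matrix.diagonal d)⁻¹ = Matrix.diagonal (fun i => (d i)⁻¹) := by
  apply Matrix.inv_eq_right_inv
  rw [Matrix.diagonal_mul_diagonal]
  simp [hd]

theorem pd_diagonal {n : ℕ} (d : Fin n → (Fin n → ℝ) → ℝ) (k i j : Fin n) (x : Fin n → ℝ) :
    pd k (fun y => Matrix.diagonal (fun a => d a y) i j) x = if i = j then pd k (d i) x else 0 := by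
  by_cases h : i = j
  · subst h; simp
  · simp [h, pd_const]

theorem christoffel_diagonal {n : ℕ} (d : Fin n → (Fin n → ℝ) → ℝ) (l i j : Fin n)
    (x : Fin n → ℝ) (hd : ∀ i, d i x ≠ 0) :
    christoffel (fun y => Matrix.diagonal (fun a => d a y)) l i j x =
      (1 / 2) * (d l x)⁻¹ * ((if l = j then pd i (d l) x else 0)
        + (if l = i then pd j (d l) x else 0) - if i = j then pd l (d i) x else 0) := by
  simp only [christoffel, inv_diagonal_of_ne_zero hd, pd_diagonal]
  rw [Finset.sum_eq_single l (fun m _ hm => by simp [Matrix.diagonal_apply_ne _ hm.symm])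
    (by simp)]
  simp only [Matrix.diagonal_apply_eq]
  ring

/-! ### Kinematics of comoving observers in a diagonal metric with conformally flat slices -/

section Comoving

variable (A W : (Fin 4 → ℝ) → ℝ)

/-- The metric `-A² dt² + W² (dx² + dy² + dz²)`. -/
noncomputable def lapseMetric : MetricField 4 := fun x =>
  Matrix.diagonal ![- (A x) ^ 2, (W x) ^ 2, (W x) ^ 2, (W x) ^ 2]

/-- The unit velocity `A⁻¹ ∂_t` of the comoving observers. -/
noncomputable def lapseVelocity : VectorField4 := fun x => ![1 / A x, 0, 0, 0]

/-- The diagonal components of `lapseMetric`. -/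
noncomputable def lapseDiag (i : Fin 4) (x : Fin 4 → ℝ) : ℝ :=
  if i = 0 then - (A x) ^ 2 else (W x) ^ 2

theorem lapseMetric_eq :
    lapseMetric A W = fun y => Matrix.diagonal (fun a => lapseDiag A W a y) := by
  funext y
  unfold lapseMetric
  congr 1
  funext i
  fin_cases i <;> simp [lapseDiag]

theorem lower_lapse (μ : Fin 4) :
    lower (lapseMetric A W) (lapseVelocity A) μ = fun x => if μ = 0 then - A x else 0 := by
  funext x
  -- The identity is needed at every point, since `covDeriv` differentiates it; where `A = 0`, the
  -- convention `1 / 0 = 0` makes both sides vanish.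
  by_cases h : A x = 0
  · fin_cases μ <;> simp [lower, lapseMetric, lapseVelocity, Fin.sum_univ_four, h]
  · fin_cases μ <;> simp [lower, lapseMetric, lapseVelocity, Fin.sum_univ_four]
    field_simp

variable {A W} {x : Fin 4 → ℝ} (hA : DifferentiableAt ℝ A x) (hW : DifferentiableAt ℝ W x)
  (hA0 : A x ≠ 0) (hW0 : W x ≠ 0)

theorem lapseDiag_ne_zero (hA0 : A x ≠ 0) (hW0 : W x ≠ 0) (i : Fin 4) :
    lapseDiag A W i x ≠ 0 := by
  unfold lapseDiag
  split_ifs <;> simp [hA0, hW0]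

theorem pd_lapseDiag (hA : DifferentiableAt ℝ A x) (hW : DifferentiableAt ℝ W x) (k i : Fin 4) :
    pd k (lapseDiag A W i) x =
      if i = 0 then - (2 * A x * pd k A x) else 2 * W x * pd k W x := by
  unfold lapseDiag
  by_cases h : i = 0
  · simp only [h, if_true]
    rw [pd_neg, pd_sq k hA]
  · simp only [h, if_false]
    rw [pd_sq k hW]

include hA hW hA0 hW0

theorem covDeriv_lapse (μ ν : Fin 4) :
    covDeriv (lapseMetric A W) (lapseVelocity A) μ ν x =
      if μ = 0 then (if ν = 0 then 0 else pd ν A x)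
      else if μ = ν then W x * pd 0 W x / A x else 0 := by
  -- The covector `u` has only a time component, so only the symbols with upper index `0`
  -- contribute.
  have hΓ : ∀ ν', christoffel (lapseMetric A W) 0 μ ν' x = _ := fun ν' => by
    rw [lapseMetric_eq, christoffel_diagonal _ _ _ _ _ (lapseDiag_ne_zero hA0 hW0)]
  unfold covDeriv
  simp only [lower_lapse, Fin.sum_univ_four, hΓ, pd_lapseDiag hA hW]
  fin_cases μ <;> fin_cases ν <;> simp [pd_neg, pd_const, lapseDiag] <;> field_simp <;> ring

theorem expansion_lapse :
    expansion (lapseMetric A W) (lapseVelocity A) x = 3 * pd 0 W x / (W x * A x) := by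
  unfold expansion
  simp only [covDeriv_lapse hA hW hA0 hW0]
  rw [lapseMetric_eq, inv_diagonal_of_ne_zero (lapseDiag_ne_zero hA0 hW0)]
  simp [Fin.sum_univ_four, lapseDiag]
  field_simp
  ring

theorem acceleration_lapse (ν : Fin 4) :
    acceleration (lapseMetric A W) (lapseVelocity A) ν x = if ν = 0 then 0 else pd ν A x / A x := by
  unfold acceleration
  simp only [covDeriv_lapse hA hW hA0 hW0]
  simp [Fin.sum_univ_four, lapseVelocity]
  split_ifs <;> ring

omit hA hW hW0 in
theorem projector_lapse (μ ν : Fin 4) :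
    projector (lapseMetric A W) (lapseVelocity A) μ ν x =
      if μ = ν then (if μ = 0 then 0 else 1) else 0 := by
  unfold projector
  simp only [lower_lapse]
  fin_cases μ <;> fin_cases ν <;> simp [lapseVelocity, hA0]

/-- The projection of `∇u` is `∂₀W/(W A)` times the spatial metric `W² δ`: it is pure trace. -/
theorem shear_lapse (μ ν : Fin 4) :
    shear (lapseMetric A W) (lapseVelocity A) μ ν x = 0 := by
  unfold shear
  simp only [covDeriv_lapse hA hW hA0 hW0, projector_lapse hA0, expansion_lapse hA hW hA0 hW0,
    lower_lapse, Fin.sum_univ_four]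
  rw [lapseMetric_eq]
  fin_cases μ <;> fin_cases ν <;> simp [lapseDiag] <;> field_simp <;> ring_nf <;> simp

omit hA hW hW0 in
theorem perpGrad_lapse (f : (Fin 4 → ℝ) → ℝ) (μ : Fin 4) :
    perpGrad (lapseMetric A W) (lapseVelocity A) f μ x = if μ = 0 then 0 else pd μ f x := by
  unfold perpGrad
  simp only [projector_lapse hA0, Fin.sum_univ_four]
  fin_cases μ <;> simp

end Comoving

theorem along_lapse (A f : (Fin 4 → ℝ) → ℝ) (x : Fin 4 → ℝ) :
    along (lapseVelocity A) f x = pd 0 f x / A x := by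
  simp [along, lapseVelocity, Fin.sum_univ_four]
  ring

/-! ### The conformally flat metric `ψ⁻² δ` of constant curvature -/

/-- The conformal factor `ψ = 1 + (ε/4) r² + 2 β z`. -/
noncomputable def conformalFactor (ε β : ℝ) (y : Fin 3 → ℝ) : ℝ :=
  1 + ε / 4 * (y 0 ^ 2 + y 1 ^ 2 + y 2 ^ 2) + 2 * β * y 2

/-- The components of the gradient of `conformalFactor`. -/
noncomputable def conformalGradient (ε β : ℝ) (i : Fin 3) (y : Fin 3 → ℝ) : ℝ :=
  ε / 2 * y i + if i = 2 then 2 * β else 0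

/-- The conformally flat metric `ψ⁻² (dx² + dy² + dz²)`. -/
noncomputable def conformalMetric (ε β : ℝ) : MetricField 3 := fun y =>
  Matrix.diagonal fun _ => (conformalFactor ε β y ^ 2)⁻¹

theorem differentiableAt_conformalFactor (ε β : ℝ) (y : Fin 3 → ℝ) :
    DifferentiableAt ℝ (conformalFactor ε β) y := by
  unfold conformalFactor
  fun_prop

theorem pd_conformalFactor (ε β : ℝ) (i : Fin 3) (y : Fin 3 → ℝ) :
    pd i (conformalFactor ε β) y = conformalGradient ε β i y := by
  unfold conformalFactor
  have h : ∀ j : Fin 3, DifferentiableAt ℝ (fun x : Fin 3 → ℝ => x j) y := differentiableAt_coord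
  have h2 : ∀ j : Fin 3, DifferentiableAt ℝ (fun x : Fin 3 → ℝ => x j ^ 2) y := fun j => (h j).pow 2
  rw [pd_add i (by fun_prop) (by fun_prop), pd_add i (by fun_prop) (by fun_prop), pd_const,
    pd_const_mul i _ (by fun_prop), pd_const_mul i _ (by fun_prop),
    pd_add i (by fun_prop) (by fun_prop), pd_add i (by fun_prop) (by fun_prop),
    pd_sq i (h 0), pd_sq i (h 1), pd_sq i (h 2)]
  simp only [pd_coord, conformalGradient]
  fin_cases i <;> simp <;> ring

theorem pd_conformalGradient (ε β : ℝ) (i j : Fin 3) (y : Fin 3 → ℝ) :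
    pd i (conformalGradient ε β j) y = if j = i then ε / 2 else 0 := by
  unfold conformalGradient
  rw [pd_add i (by fun_prop) (by fun_prop), pd_const, pd_const_mul i _ (by fun_prop), pd_coord]
  simp

theorem differentiableAt_conformalGradient (ε β : ℝ) (j : Fin 3) (y : Fin 3 → ℝ) :
    DifferentiableAt ℝ (conformalGradient ε β j) y := by
  unfold conformalGradient
  fun_prop

/-- `-ψ` times the Christoffel symbols of `conformalMetric`. -/
noncomputable def conformalChristoffel (ε β : ℝ) (l i j : Fin 3) (y : Fin 3 → ℝ) : ℝ :=
  (if l = j then 1 else 0) * conformalGradient ε β i y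
    + (if l = i then 1 else 0) * conformalGradient ε β j y
    - (if i = j then 1 else 0) * conformalGradient ε β l y

theorem christoffel_conformalMetric {ε β : ℝ} {y : Fin 3 → ℝ} (hy : conformalFactor ε β y ≠ 0)
    (l i j : Fin 3) :
    christoffel (conformalMetric ε β) l i j y
      = - (conformalChristoffel ε β l i j y / conformalFactor ε β y) := by
  have hd := differentiableAt_conformalFactor ε β y
  have hp : ∀ k, pd k (fun x => (conformalFactor ε β x ^ 2)⁻¹) y
      = -2 * conformalGradient ε β k y / conformalFactor ε β y ^ 3 := fun k => by
    rw [pd_inv k (f := fun x => conformalFactor ε β x ^ 2) (hd.pow 2) (pow_ne_zero 2 hy),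
      pd_sq k hd, pd_conformalFactor]
    field_simp
  unfold conformalMetric conformalChristoffel
  rw [christoffel_diagonal (fun _ x => (conformalFactor ε β x ^ 2)⁻¹) l i j y
    (fun _ => inv_ne_zero (pow_ne_zero 2 hy))]
  simp only [hp]
  split_ifs <;> field_simp <;> ring

theorem pd_christoffel_conformalMetric {ε β : ℝ} {y : Fin 3 → ℝ}
    (hy : conformalFactor ε β y ≠ 0) (m l i j : Fin 3) :
    pd m (christoffel (conformalMetric ε β) l i j) y
      = - ((ε / 2) * ((if l = j then 1 else 0) * (if i = m then 1 else 0)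
            + (if l = i then 1 else 0) * (if j = m then 1 else 0)
            - (if i = j then 1 else 0) * (if l = m then 1 else 0)) / conformalFactor ε β y)
        + conformalChristoffel ε β l i j y * conformalGradient ε β m y
          / conformalFactor ε β y ^ 2 := by
  have hd := differentiableAt_conformalFactor ε β y
  have hg := fun k => differentiableAt_conformalGradient ε β k y
  have hev : ∀ᶠ x in nhds y, conformalFactor ε β x ≠ 0 := hd.continuousAt.eventually_ne hy
  have hc : DifferentiableAt ℝ (conformalChristoffel ε β l i j) y := by
    unfold conformalChristoffel
    exact (((hg i).const_mul _).add ((hg j).const_mul _)).sub ((hg l).const_mul _)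
  rw [pd_congr m (hev.mono fun x hx => christoffel_conformalMetric hx l i j), pd_neg,
    pd_div m hc hd hy, pd_conformalFactor]
  have : pd m (conformalChristoffel ε β l i j) y
      = (ε / 2) * ((if l = j then 1 else 0) * (if i = m then 1 else 0)
            + (if l = i then 1 else 0) * (if j = m then 1 else 0)
            - (if i = j then 1 else 0) * (if l = m then 1 else 0)) := by
    unfold conformalChristoffel
    rw [pd_sub m (by fun_prop) (by fun_prop), pd_add m (by fun_prop) (by fun_prop), pd_const_mul m _ (hg i),
      pd_const_mul m _ (hg j), pd_const_mul m _ (hg l)]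
    simp only [pd_conformalGradient]
    split_ifs <;> ring
  rw [this]
  field_simp
  ring

/-- The Hessian of `ψ` is `(ε/2) δ`, so `ψ⁻² δ` has sectional curvature `εψ - |∇ψ|²`; this identity
shows that it is constant. -/
theorem conformalGradient_sq_sum (ε β : ℝ) (y : Fin 3 → ℝ) :
    conformalGradient ε β 0 y ^ 2 + conformalGradient ε β 1 y ^ 2 + conformalGradient ε β 2 y ^ 2
      = ε * conformalFactor ε β y - (ε - 4 * β ^ 2) := by
  simp [conformalGradient, conformalFactor]
  ring

theorem hasConstantCurvatureOn_conformalMetric {ε β : ℝ} {S : Set (Fin 3 → ℝ)}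
    (hS : ∀ y ∈ S, conformalFactor ε β y ≠ 0) :
    HasConstantCurvatureOn (conformalMetric ε β) S (ε - 4 * β ^ 2) := by
  intro y hy
  have h0 := hS y hy
  refine ⟨Matrix.PosDef.diagonal fun _ => by positivity, fun l k i j => ?_⟩
  -- With `κ` in this form, each curvature component is a rational identity in which `ψ` and the
  -- components of its gradient are independent variables.
  have hκ : ε - 4 * β ^ 2 = ε * conformalFactor ε β y - (conformalGradient ε β 0 y ^ 2
      + conformalGradient ε β 1 y ^ 2 + conformalGradient ε β 2 y ^ 2) := by
    rw [conformalGradient_sq_sum]; ring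
  unfold riemann
  simp only [pd_christoffel_conformalMetric h0, christoffel_conformalMetric h0, hκ,
    Fin.sum_univ_three, conformalChristoffel, conformalMetric, Matrix.diagonal_apply]
  generalize conformalFactor ε β y = ψ at *
  fin_cases l <;> fin_cases k <;> fin_cases i <;> fin_cases j <;> simp <;> field_simp <;> ring

/-! ### Linear relations on infinite sets -/

theorem quadratic_coeffs_eq_zero {S : Set ℝ} (hS : S.Infinite) {a b c : ℝ}
    (h : ∀ w ∈ S, a + b * w + c * w ^ 2 = 0) : a = 0 ∧ b = 0 ∧ c = 0 := by
  open Polynomial in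
  have hp : (C a + C b * X + C c * X ^ 2 : ℝ[X]) = 0 :=
    eq_zero_of_infinite_isRoot _ (hS.mono fun w hw => by simpa using h w hw)
  refine ⟨?_, ?_, ?_⟩
  · simpa using congrArg (fun p => p.coeff 0) hp
  · simpa using congrArg (fun p => p.coeff 1) hp
  · simpa using congrArg (fun p => p.coeff 2) hp

/-- The functions `(1 + bᵢ w)⁻³` with distinct poles are linearly independent. -/
theorem coeff_eq_zero_of_inv_cube_relation {S : Set ℝ} (hS : S.Infinite) {b₁ b₂ b₃ c₁ c₂ c₃ : ℝ}
    (h₁ : b₁ ≠ 0) (h₁₂ : b₁ ≠ b₂) (h₁₃ : b₁ ≠ b₃)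
    (hn₁ : ∀ w ∈ S, 1 + b₁ * w ≠ 0) (hn₂ : ∀ w ∈ S, 1 + b₂ * w ≠ 0)
    (hn₃ : ∀ w ∈ S, 1 + b₃ * w ≠ 0)
    (h : ∀ w ∈ S, c₁ / (1 + b₁ * w) ^ 3 + c₂ / (1 + b₂ * w) ^ 3 + c₃ / (1 + b₃ * w) ^ 3 = 0) :
    c₁ = 0 := by
  open Polynomial in
  have hp : (C c₁ * (1 + C b₂ * X) ^ 3 * (1 + C b₃ * X) ^ 3
      + C c₂ * (1 + C b₁ * X) ^ 3 * (1 + C b₃ * X) ^ 3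
      + C c₃ * (1 + C b₁ * X) ^ 3 * (1 + C b₂ * X) ^ 3 : ℝ[X]) = 0 := by
    refine eq_zero_of_infinite_isRoot _ (hS.mono fun w hw => ?_)
    have e := h w hw
    have e₁ := hn₁ w hw
    have e₂ := hn₂ w hw
    have e₃ := hn₃ w hw
    simp only [Set.mem_ofPred_eq, IsRoot.def, eval_add, eval_mul, eval_pow, eval_C, eval_X, eval_one]
    rw [div_add_div _ _ (pow_ne_zero 3 e₁) (pow_ne_zero 3 e₂),
      div_add_div _ _ (mul_ne_zero (pow_ne_zero 3 e₁) (pow_ne_zero 3 e₂)) (pow_ne_zero 3 e₃),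
      div_eq_zero_iff] at e
    rcases e with e | e
    · linear_combination e
    · exact absurd e (mul_ne_zero (mul_ne_zero (pow_ne_zero 3 e₁) (pow_ne_zero 3 e₂))
        (pow_ne_zero 3 e₃))
  -- At the root of `1 + b₁ X` the second and third terms vanish, while the cofactor of `c₁` does
  -- not.
  have hr := congrArg (Polynomial.eval (-1 / b₁)) hp
  have hz : 1 + b₁ * (-1 / b₁) = 0 := by field_simp; ring
  have hk : ∀ b, b₁ ≠ b → 1 + b * (-1 / b₁) ≠ 0 := fun b hb hb' => by
    have e : b₁ * (1 + b * (-1 / b₁)) = b₁ - b := by field_simp; ring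
    rw [hb', mul_zero] at e
    exact hb (sub_eq_zero.1 e.symm)
  simpa [hz, hk b₂ h₁₂, hk b₃ h₁₃] using hr

/-- The functions `z ↦ 2 z / (k + m z²)` take infinitely many values on an infinite set. -/
theorem infinite_image_div_quadratic {S : Set ℝ} (hS : S.Infinite) (k m : ℝ)
    (hq : ∀ z ∈ S, k + m * z ^ 2 ≠ 0) :
    ((fun z => 2 * z / (k + m * z ^ 2)) '' S).Infinite := by
  intro hfin
  refine hS ((hfin.biUnion (t := fun v => {z | z ∈ S ∧ 2 * z / (k + m * z ^ 2) = v})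
    fun v _ => ?_).subset fun z hz => ?_)
  -- The fibre over `v` solves `2z = v (k + m z²)`, whose linear coefficient `2` never vanishes.
  · by_contra hinf
    have := quadratic_coeffs_eq_zero (a := - (v * k)) (b := 2) (c := - (v * m)) hinf
      fun z hz => by
        have e := hz.2
        rw [div_eq_iff (hq z hz.1)] at e
        linear_combination e
    norm_num at this
  · simp only [Set.mem_iUnion]
    exact ⟨_, Set.mem_image_of_mem _ hz, hz, rfl⟩

/-- A function with non-zero derivative takes three distinct non-zero values near a point. -/
theorem exists_three_values {b : ℝ → ℝ} {t₀ d : ℝ} {I : Set ℝ} (hI : I ∈ nhds t₀)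
    (hb : HasDerivAt b d t₀) (hd : d ≠ 0) :
    ∃ t₁ ∈ I, ∃ t₂ ∈ I, ∃ t₃ ∈ I, b t₁ ≠ 0 ∧ b t₂ ≠ 0 ∧ b t₃ ≠ 0 ∧
      b t₁ ≠ b t₂ ∧ b t₁ ≠ b t₃ ∧ b t₂ ≠ b t₃ := by
  have hI' : ∀ᶠ t in nhdsWithin t₀ {t₀}ᶜ, t ∈ I := nhdsWithin_le_nhds hI
  have hne := fun c => hb.eventually_ne (c := c) hd
  obtain ⟨t₁, h₁, z₁⟩ := (hI'.and (hne 0)).exists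
  obtain ⟨t₂, h₂, z₂, d₂⟩ := (hI'.and ((hne 0).and (hne (b t₁)))).exists
  obtain ⟨t₃, h₃, z₃, d₃, d₃'⟩ :=
    (hI'.and ((hne 0).and ((hne (b t₁)).and (hne (b t₂))))).exists
  exact ⟨t₁, h₁, t₂, h₂, t₃, h₃, z₁, z₂, z₃, d₂.symm, d₃.symm, d₃'.symm⟩

/-- If `s(z) - c(t) M(z) / (1 + b(t) w(z))³` depends on `t` only at three times at which `b` is
non-zero with distinct values, and `M ≠ 0`, `c ≠ 0`, then `w` takes finitely many values. -/
theorem not_separated_of_infinite {Z : Set ℝ} {s M w : ℝ → ℝ} (hw : (w '' Z).Infinite)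
    {b₁ b₂ b₃ c₁ c₂ c₃ A₁ A₂ A₃ : ℝ} (h₁ : b₁ ≠ 0) (h₃ : b₃ ≠ 0)
    (h₁₂ : b₁ ≠ b₂) (h₁₃ : b₁ ≠ b₃) (h₂₃ : b₂ ≠ b₃)
    (hn₁ : ∀ z ∈ Z, 1 + b₁ * w z ≠ 0) (hn₂ : ∀ z ∈ Z, 1 + b₂ * w z ≠ 0)
    (hn₃ : ∀ z ∈ Z, 1 + b₃ * w z ≠ 0) (hM : ∀ z ∈ Z, M z ≠ 0)
    (hc₁ : c₁ ≠ 0) (hc₃ : c₃ ≠ 0)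
    (e₁ : ∀ z ∈ Z, s z - c₁ * M z / (1 + b₁ * w z) ^ 3 = A₁)
    (e₂ : ∀ z ∈ Z, s z - c₂ * M z / (1 + b₂ * w z) ^ 3 = A₂)
    (e₃ : ∀ z ∈ Z, s z - c₃ * M z / (1 + b₃ * w z) ^ 3 = A₃) : False := by
  have n₁ : ∀ v ∈ w '' Z, 1 + b₁ * v ≠ 0 := by rintro _ ⟨z, hz, rfl⟩; exact hn₁ z hz
  have n₂ : ∀ v ∈ w '' Z, 1 + b₂ * v ≠ 0 := by rintro _ ⟨z, hz, rfl⟩; exact hn₂ z hz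
  have n₃ : ∀ v ∈ w '' Z, 1 + b₃ * v ≠ 0 := by rintro _ ⟨z, hz, rfl⟩; exact hn₃ z hz
  -- The weights `A₂ - A₃`, `A₃ - A₁`, `A₁ - A₂` sum to zero, and so do their products with `A₁`,
  -- `A₂`, `A₃`; hence `s` and all the constants drop out, and `M` factors out.
  have key : ∀ v ∈ w '' Z, ((A₂ - A₃) * c₁) / (1 + b₁ * v) ^ 3
      + ((A₃ - A₁) * c₂) / (1 + b₂ * v) ^ 3 + ((A₁ - A₂) * c₃) / (1 + b₃ * v) ^ 3 = 0 := by
    rintro _ ⟨z, hz, rfl⟩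
    apply mul_left_cancel₀ (hM z hz)
    rw [← e₁ z hz, ← e₂ z hz, ← e₃ z hz]
    ring
  have k₁ := coeff_eq_zero_of_inv_cube_relation hw h₁ h₁₂ h₁₃ n₁ n₂ n₃ key
  have k₃ : (A₁ - A₂) * c₃ = 0 := coeff_eq_zero_of_inv_cube_relation hw h₃ h₁₃.symm h₂₃.symm
    n₃ n₁ n₂ (c₂ := (A₂ - A₃) * c₁) (c₃ := (A₃ - A₁) * c₂)
    fun v hv => by linear_combination key v hv
  have hA : A₁ = A₂ := by simpa [hc₃, sub_eq_zero] using k₃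
  refine hc₁ (coeff_eq_zero_of_inv_cube_relation (c₁ := c₁) (c₂ := - c₂) (c₃ := 0)
    hw h₁ h₁₂ h₁₃ n₁ n₂ n₃ ?_)
  rintro _ ⟨z, hz, rfl⟩
  apply mul_left_cancel₀ (hM z hz)
  have := (e₁ z hz).trans (hA.trans (e₂ z hz).symm)
  linear_combination - this

/-! ### Smoothness and time independence of the spatial functions -/

theorem pd_eq_zero_of_update {n : ℕ} {f : (Fin n → ℝ) → ℝ} {x : Fin n → ℝ} (i : Fin n)
    (hf : DifferentiableAt ℝ f x) (h : ∀ v, f (Function.update x i v) = f x) :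
    pd i f x = 0 := by
  have hl := hasDerivAt_comp_of_single (f := f) i (hasDerivAt_update x i (x i))
    (by rwa [Function.update_eq_self])
  rw [Function.update_eq_self] at hl
  simp only [h] at hl
  exact hl.unique (hasDerivAt_const _ _)

theorem ContDiffAt.deriv_of_infty {f : ℝ → ℝ} {t : ℝ} (hf : ContDiffAt ℝ ∞ f t) :
    ContDiffAt ℝ ∞ (deriv f) t := by
  have h : ContDiffAt ℝ ∞ (fderiv ℝ f) t := hf.fderiv_right (by simp)
  exact h.clm_apply contDiffAt_const

theorem ContDiffAt.comp_coord {n : ℕ} {f : ℝ → ℝ} {x : Fin n → ℝ} (i : Fin n)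
    (hf : ContDiffAt ℝ ∞ f (x i)) : ContDiffAt ℝ ∞ (fun y => f (y i)) x :=
  ContDiffAt.comp x hf (contDiff_apply ℝ ℝ i).contDiffAt

namespace StephaniData

variable {U : StephaniData} {x : Fin 4 → ℝ}

theorem metric_eq_lapseMetric (U : StephaniData) : U.metric = lapseMetric U.α U.Ω := rfl

theorem velocity_eq_lapseVelocity (U : StephaniData) : U.velocity = lapseVelocity U.α := rfl

theorem contDiff_q (U : StephaniData) : ContDiff ℝ ∞ U.q := by
  unfold q
  fun_prop

theorem contDiffAt_w (hq : U.q x ≠ 0) : ContDiffAt ℝ ∞ U.w x := by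
  unfold w
  exact ContDiffAt.div (by fun_prop) U.contDiff_q.contDiffAt hq

theorem pd_zero_w (hq : U.q x ≠ 0) : pd 0 U.w x = 0 :=
  pd_eq_zero_of_update 0 ((contDiffAt_w hq).differentiableAt (by simp)) fun v => by simp [w, q]

theorem pd_zero_q : pd 0 U.q x = 0 :=
  pd_eq_zero_of_update 0 (U.contDiff_q.contDiffAt.differentiableAt (by simp)) fun v => by simp [q]

end StephaniData

/-! ### Lapse, conformal factor, kinematics and energy density of the Stephani fluid -/

namespace IsThermodynamicStephani

variable {U : StephaniData} (hU : IsThermodynamicStephani U) {x : Fin 4 → ℝ} (hx : x ∈ U.D)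

include hU hx

theorem contDiffAt_one_add_bw :
    ContDiffAt ℝ ∞ (fun y => 1 + U.b (y 0) * U.w y) x :=
  contDiffAt_const.add
    (((hU.smooth_b x hx).comp_coord 0).mul (StephaniData.contDiffAt_w (hU.q_ne_zero x hx)))

theorem contDiffAt_L : ContDiffAt ℝ ∞ U.L x :=
  ((hU.smooth_R x hx).comp_coord 0).div (hU.contDiffAt_one_add_bw hx) (hU.one_add_bw_ne_zero x hx)

theorem contDiffAt_Ω : ContDiffAt ℝ ∞ U.Ω x :=
  (contDiffAt_const.div U.contDiff_q.contDiffAt (hU.q_ne_zero x hx)).mul (hU.contDiffAt_L hx)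

theorem L_ne_zero : U.L x ≠ 0 :=
  div_ne_zero (hU.R_ne_zero x hx) (hU.one_add_bw_ne_zero x hx)

theorem Ω_ne_zero : U.Ω x ≠ 0 :=
  mul_ne_zero (one_div_ne_zero (hU.q_ne_zero x hx)) (hU.L_ne_zero hx)

theorem differentiableAt_R : DifferentiableAt ℝ U.R (x 0) :=
  (hU.smooth_R x hx).differentiableAt (by simp)

theorem differentiableAt_b : DifferentiableAt ℝ U.b (x 0) :=
  (hU.smooth_b x hx).differentiableAt (by simp)

theorem pd_zero_L : pd 0 U.L x =
    ((1 + U.b (x 0) * U.w x) * deriv U.R (x 0) - U.R (x 0) * (deriv U.b (x 0) * U.w x))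
      / (1 + U.b (x 0) * U.w x) ^ 2 := by
  have hq := hU.q_ne_zero x hx
  have hR := hU.differentiableAt_R hx
  have hb := hU.differentiableAt_b hx
  have hw := (StephaniData.contDiffAt_w hq).differentiableAt (by simp)
  have hb' : DifferentiableAt ℝ (fun y : Fin 4 → ℝ => U.b (y 0)) x :=
    hb.comp x (differentiableAt_coord 0)
  have hR' : DifferentiableAt ℝ (fun y : Fin 4 → ℝ => U.R (y 0)) x :=
    hR.comp x (differentiableAt_coord 0)
  unfold StephaniData.L
  rw [pd_div 0 hR' (by fun_prop) (hU.one_add_bw_ne_zero x hx),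
    pd_add 0 (by fun_prop) (by fun_prop), pd_const, pd_mul 0 hb' hw, StephaniData.pd_zero_w hq,
    pd_comp_coord 0 0 hR, pd_comp_coord 0 0 hb]
  simp only [if_true]
  ring

theorem α_eq_pd_L : U.α x = U.R (x 0) * pd 0 U.L x / (U.L x * deriv U.R (x 0)) := by
  unfold StephaniData.α
  rw [pd_log 0 ((hU.contDiffAt_L hx).differentiableAt (by simp)) (hU.L_ne_zero hx)]
  rw [div_div, mul_div_assoc]

/-- Space enters only through `w`, and the inhomogeneous term carries the factor `ḃ`. -/
theorem α_eq : U.α x = 1 - U.R (x 0) * deriv U.b (x 0) / deriv U.R (x 0)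
    * (U.w x / (1 + U.b (x 0) * U.w x)) := by
  rw [hU.α_eq_pd_L hx, hU.pd_zero_L hx, StephaniData.L]
  have h1 := hU.one_add_bw_ne_zero x hx
  have h2 := hU.R_ne_zero x hx
  have h3 := hU.deriv_R_ne_zero x hx
  field_simp

/-- `α` is by definition `R ∂_R ln L`, and `Ω` differs from `L` by a static factor. The `α` here
cancels in the expansion, which is thus homogeneous. -/
theorem pd_zero_Ω : pd 0 U.Ω x = U.α x * U.Ω x * deriv U.R (x 0) / U.R (x 0) := by
  have hq := hU.q_ne_zero x hx
  have hqd : DifferentiableAt ℝ U.q x := U.contDiff_q.contDiffAt.differentiableAt (by simp)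
  have h1 := hU.L_ne_zero hx
  have h2 := hU.R_ne_zero x hx
  have h3 := hU.deriv_R_ne_zero x hx
  have hz : pd 0 (fun y => 1 / U.q y) x = 0 := by
    simp only [one_div]
    rw [pd_inv 0 hqd hq, StephaniData.pd_zero_q]
    simp
  rw [hU.α_eq_pd_L hx]
  unfold StephaniData.Ω
  rw [pd_mul 0 (f := fun y => 1 / U.q y) (by fun_prop (disch := exact hq))
    ((hU.contDiffAt_L hx).differentiableAt (by simp)), hz]
  field_simp
  ring

theorem contDiffAt_α : ContDiffAt ℝ ∞ U.α x := by
  have hev : U.α =ᶠ[nhds x] fun y => 1 - U.R (y 0) * deriv U.b (y 0) / deriv U.R (y 0)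
      * (U.w y / (1 + U.b (y 0) * U.w y)) := by
    filter_upwards [hU.isOpen.mem_nhds hx] with y hy using hU.α_eq hy
  refine ContDiffAt.congr_of_eventuallyEq ?_ hev
  exact contDiffAt_const.sub (((((hU.smooth_R x hx).comp_coord 0).mul
    ((hU.smooth_b x hx).deriv_of_infty.comp_coord 0)).div
    ((hU.smooth_R x hx).deriv_of_infty.comp_coord 0) (hU.deriv_R_ne_zero x hx)).mul
    ((StephaniData.contDiffAt_w (hU.q_ne_zero x hx)).div (hU.contDiffAt_one_add_bw hx)
      (hU.one_add_bw_ne_zero x hx)))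

theorem differentiableAt_α : DifferentiableAt ℝ U.α x :=
  (hU.contDiffAt_α hx).differentiableAt (by simp)

theorem differentiableAt_Ω : DifferentiableAt ℝ U.Ω x :=
  (hU.contDiffAt_Ω hx).differentiableAt (by simp)

theorem expansion_eq : expansion U.metric U.velocity x = 3 * deriv U.R (x 0) / U.R (x 0) := by
  rw [U.metric_eq_lapseMetric, U.velocity_eq_lapseVelocity,
    expansion_lapse (hU.differentiableAt_α hx) (hU.differentiableAt_Ω hx) (hU.α_ne_zero x hx)
      (hU.Ω_ne_zero hx), hU.pd_zero_Ω hx]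
  have h1 := hU.α_ne_zero x hx
  have h2 := hU.Ω_ne_zero hx
  field_simp

theorem acceleration_eq (ν : Fin 4) :
    acceleration U.metric U.velocity ν x = if ν = 0 then 0 else pd ν U.α x / U.α x :=
  acceleration_lapse (hU.differentiableAt_α hx) (hU.differentiableAt_Ω hx) (hU.α_ne_zero x hx)
    (hU.Ω_ne_zero hx) ν

omit hx in
theorem shearViscosityCompatible : U.ShearViscosityCompatible := fun _ hx μ ν =>
  shear_lapse (hU.differentiableAt_α hx) (hU.differentiableAt_Ω hx) (hU.α_ne_zero _ hx)
    (hU.Ω_ne_zero hx) μ ν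

theorem contDiffAt_rhoOfTime : ContDiffAt ℝ ∞ U.rhoOfTime (x 0) := by
  have hR := hU.smooth_R x hx
  exact (contDiffAt_const.div (hR.pow 2) (pow_ne_zero 2 (hU.R_ne_zero x hx))).mul
    (((hR.deriv_of_infty.pow 2).add contDiffAt_const).sub
      (contDiffAt_const.mul ((hU.smooth_b x hx).pow 2)))

theorem pd_ρ (μ : Fin 4) : pd μ U.ρ x = if 0 = μ then deriv U.rhoOfTime (x 0) else 0 :=
  pd_comp_coord μ 0 ((hU.contDiffAt_rhoOfTime hx).differentiableAt (by simp))

end IsThermodynamicStephani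

/-! ### Coordinate boxes in the `(t, z)`-plane through an event -/

theorem eq_on_ball_of_hasDerivAt_zero {f : ℝ → ℝ} {c r : ℝ}
    (h : ∀ v ∈ Metric.ball c r, HasDerivAt f 0 v) {v₁ v₂ : ℝ} (h₁ : v₁ ∈ Metric.ball c r)
    (h₂ : v₂ ∈ Metric.ball c r) : f v₁ = f v₂ :=
  Metric.isOpen_ball.is_const_of_deriv_eq_zero (convex_ball c r).isPreconnected
    (fun v hv => (h v hv).differentiableAt.differentiableWithinAt) (fun v hv => (h v hv).deriv)
    h₁ h₂

/-- The event with the coordinates `x`, `y` of `p` and the given `t`, `z`. -/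
def planeEvent (p : Fin 4 → ℝ) (t z : ℝ) : Fin 4 → ℝ := ![t, p 1, p 2, z]

theorem planeEvent_self (p : Fin 4 → ℝ) : planeEvent p (p 0) (p 3) = p := by
  funext i
  fin_cases i <;> rfl

@[simp] theorem planeEvent_zero (p : Fin 4 → ℝ) (t z : ℝ) : planeEvent p t z 0 = t := rfl

theorem hasDerivAt_planeEvent_left (p : Fin 4 → ℝ) (t z : ℝ) :
    HasDerivAt (fun v => planeEvent p v z) (Pi.single 0 1) t := by
  rw [hasDerivAt_pi]
  intro i
  fin_cases i
  · exact hasDerivAt_id t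
  all_goals exact hasDerivAt_const t _

theorem hasDerivAt_planeEvent_right (p : Fin 4 → ℝ) (t z : ℝ) :
    HasDerivAt (fun v => planeEvent p t v) (Pi.single 3 1) z := by
  rw [hasDerivAt_pi]
  intro i
  fin_cases i
  · exact hasDerivAt_const z _
  · exact hasDerivAt_const z _
  · exact hasDerivAt_const z _
  · exact hasDerivAt_id z

/-- Coordinate slices of `D` need not be connected, so integration along `t` or `z` takes place
inside such a box. -/
theorem exists_box_subset {D : Set (Fin 4 → ℝ)} (hD : IsOpen D) {p : Fin 4 → ℝ} (hp : p ∈ D) :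
    ∃ r > 0, ∀ t ∈ Metric.ball (p 0) r, ∀ z ∈ Metric.ball (p 3) r, planeEvent p t z ∈ D := by
  have hc : Continuous fun a : ℝ × ℝ => planeEvent p a.1 a.2 := by
    refine continuous_pi fun i => ?_
    fin_cases i
    · exact continuous_fst
    · exact continuous_const
    · exact continuous_const
    · exact continuous_snd
  obtain ⟨r, hr, hb⟩ := Metric.isOpen_iff.1 (hD.preimage hc) (p 0, p 3)
    (by simpa [planeEvent_self] using hp)
  refine ⟨r, hr, fun t ht z hz => hb (a := (t, z)) ?_⟩
  rw [← ball_prod_same]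
  exact ⟨ht, hz⟩

namespace StephaniData

variable (U : StephaniData) (p : Fin 4 → ℝ)

theorem q_planeEvent (t z : ℝ) : U.q (planeEvent p t z)
    = 1 + U.ε / 4 * (p 1 ^ 2 + p 2 ^ 2) + U.ε / 4 * z ^ 2 := by
  simp [q, planeEvent]
  ring

theorem w_planeEvent (t z : ℝ) : U.w (planeEvent p t z)
    = 2 * z / (1 + U.ε / 4 * (p 1 ^ 2 + p 2 ^ 2) + U.ε / 4 * z ^ 2) := by
  rw [w, q_planeEvent]
  rfl

theorem w_planeEvent_eq (t t' z : ℝ) : U.w (planeEvent p t z) = U.w (planeEvent p t' z) := by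
  rw [w_planeEvent, w_planeEvent]

variable {U p}

theorem infinite_image_w {t r : ℝ} (hr : 0 < r)
    (hq : ∀ z ∈ Metric.ball (p 3) r, U.q (planeEvent p t z) ≠ 0) :
    ((fun z => U.w (planeEvent p t z)) '' Metric.ball (p 3) r).Infinite := by
  simp only [w_planeEvent]
  refine infinite_image_div_quadratic ?_ _ _ fun z hz => ?_
  · rw [Real.ball_eq_Ioo]
    exact Set.Ioo_infinite (by linarith)
  · rw [← U.q_planeEvent p t z]
    exact hq z hz

end StephaniData

namespace IsThermodynamicStephani

variable {U : StephaniData} (hU : IsThermodynamicStephani U)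

include hU

/-! ### FLRW universes are those with constant `b` -/

theorem deriv_b_eq_zero_of_isFLRW (h : IsFLRW U.D U.metric) {p : Fin 4 → ℝ} (hp : p ∈ U.D) :
    deriv U.b (p 0) = 0 := by
  obtain ⟨N, S, h, κ, -, hg⟩ := h
  obtain ⟨r, hr, hbox⟩ := exists_box_subset hU.isOpen hp
  have hp0 := Metric.mem_ball_self (x := p 0) hr
  obtain ⟨k, hk⟩ : ∃ k, k = U.R (p 0) * deriv U.b (p 0) / deriv U.R (p 0) := ⟨_, rfl⟩
  -- Since `(1 + b w) α = 1 + (b - k) w`, the polynomial is `(1 + (b - k) w)² - N² (1 + b w)²`.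
  have hquad := quadratic_coeffs_eq_zero
    (a := 1 - N (p 0) ^ 2) (b := 2 * (U.b (p 0) - k) - 2 * U.b (p 0) * N (p 0) ^ 2)
    (c := (U.b (p 0) - k) ^ 2 - U.b (p 0) ^ 2 * N (p 0) ^ 2)
    (StephaniData.infinite_image_w (U := U) (p := p) (t := p 0) hr
      fun z hz => hU.q_ne_zero _ (hbox _ hp0 z hz)) (by
      rintro _ ⟨z, hz, rfl⟩
      have hmem := hbox _ hp0 z hz
      have h00 : - U.α (planeEvent p (p 0) z) ^ 2 = - N (p 0) ^ 2 := (hg _ hmem).1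
      have h1 := hU.one_add_bw_ne_zero _ hmem
      rw [hU.α_eq hmem] at h00
      simp only [planeEvent_zero, ← hk] at h00 h1 ⊢
      have hu := div_mul_cancel₀ (U.w (planeEvent p (p 0) z)) h1
      generalize U.w (planeEvent p (p 0) z) / (1 + U.b (p 0) * U.w (planeEvent p (p 0) z)) = u
        at h00 hu
      generalize U.w (planeEvent p (p 0) z) = w at hu ⊢
      linear_combination - (1 + U.b (p 0) * w) ^ 2 * h00
        + k * (2 * (1 + U.b (p 0) * w) - k * w - k * u * (1 + U.b (p 0) * w)) * hu)
  have hk0 : k = 0 := by linear_combination - hquad.2.1 / 2 + U.b (p 0) * hquad.1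
  simpa [hk, hU.R_ne_zero p hp, hU.deriv_R_ne_zero p hp] using hk0

theorem α_eq_one (hb : ∀ x ∈ U.D, deriv U.b (x 0) = 0) {x : Fin 4 → ℝ} (hx : x ∈ U.D) :
    U.α x = 1 := by
  rw [hU.α_eq hx, hb x hx]
  simp

/-- The set of times at which the universe is defined. -/
theorem isOpen_times : IsOpen ((fun x : Fin 4 → ℝ => x 0) '' U.D) :=
  isOpenMap_eval (X := fun _ : Fin 4 => ℝ) 0 _ hU.isOpen

theorem isPreconnected_times : IsPreconnected ((fun x : Fin 4 → ℝ => x 0) '' U.D) :=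
  hU.isConnected.isPreconnected.image _ (continuous_apply 0).continuousOn

theorem exists_b_eq (hb : ∀ x ∈ U.D, deriv U.b (x 0) = 0) :
    ∃ β, ∀ x ∈ U.D, U.b (x 0) = β := by
  obtain ⟨β, hβ⟩ := hU.isOpen_times.exists_is_const_of_deriv_eq_zero (f := U.b)
    hU.isPreconnected_times
    (by rintro _ ⟨x, hx, rfl⟩; exact (hU.differentiableAt_b hx).differentiableWithinAt)
    (by rintro _ ⟨x, hx, rfl⟩; exact hb x hx)
  exact ⟨β, fun x hx => hβ _ ⟨x, hx, rfl⟩⟩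

theorem isFLRW_of_deriv_b_eq_zero (hb : ∀ x ∈ U.D, deriv U.b (x 0) = 0) :
    IsFLRW U.D U.metric := by
  obtain ⟨β, hβ⟩ := hU.exists_b_eq hb
  have hψ : ∀ x ∈ U.D, conformalFactor U.ε β (spatial x) = U.q x * (1 + U.b (x 0) * U.w x) := by
    intro x hx
    have hq := hU.q_ne_zero x hx
    have e : U.q x * (1 + U.b (x 0) * U.w x) = U.q x + 2 * β * x 3 := by
      rw [hβ x hx, StephaniData.w]
      field_simp
    rw [e]
    rfl
  refine ⟨fun _ => 1, U.R, conformalMetric U.ε β, U.ε - 4 * β ^ 2,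
    hasConstantCurvatureOn_conformalMetric ?_, fun x hx => ⟨?_, fun i j => ?_⟩⟩
  · rintro _ ⟨x, hx, rfl⟩
    rw [hψ x hx]
    exact mul_ne_zero (hU.q_ne_zero x hx) (hU.one_add_bw_ne_zero x hx)
  · simp [StephaniData.metric, hU.α_eq_one hb hx]
  · have hΩ : U.Ω x ^ 2 = U.R (x 0) ^ 2 * (conformalFactor U.ε β (spatial x) ^ 2)⁻¹ := by
      rw [hψ x hx, StephaniData.Ω, StephaniData.L]
      have hq := hU.q_ne_zero x hx
      have h1 := hU.one_add_bw_ne_zero x hx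
      field_simp
    simp only [StephaniData.metric, conformalMetric]
    refine ⟨Matrix.diagonal_apply_ne _ (Fin.succ_ne_zero i).symm,
      Matrix.diagonal_apply_ne _ (Fin.succ_ne_zero i), ?_⟩
    by_cases hij : i = j
    · subst hij
      rw [Matrix.diagonal_apply_eq, Matrix.diagonal_apply_eq, ← hΩ]
      fin_cases i <;> rfl
    · rw [Matrix.diagonal_apply_ne _ hij, Matrix.diagonal_apply_ne _
        (fun e => hij (Fin.succ_injective _ e)), mul_zero]

/-! ### The perfect-fluid scheme of an FLRW universe -/

theorem pd_eq_zero_of_α_eq_one (hb : ∀ x ∈ U.D, deriv U.b (x 0) = 0) {x : Fin 4 → ℝ}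
    (hx : x ∈ U.D) (μ : Fin 4) : pd μ U.α x = 0 := by
  have hev : U.α =ᶠ[nhds x] fun _ => 1 := by
    filter_upwards [hU.isOpen.mem_nhds hx] with y hy using hU.α_eq_one hb hy
  rw [pd_congr μ hev, pd_const]

/-- `R` may be negative; its constant sign `σ` makes the density `(σ R³)⁻¹` positive. -/
theorem exists_sign_R : ∃ σ : ℝ, σ ^ 2 = 1 ∧ ∀ x ∈ U.D, 0 < σ * U.R (x 0) := by
  have hpre := hU.isPreconnected_times.image U.R (by
    rintro _ ⟨x, hx, rfl⟩
    exact (hU.differentiableAt_R hx).continuousAt.continuousWithinAt)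
  rw [Set.image_image] at hpre
  have h0 : (0 : ℝ) ∉ (fun x : Fin 4 → ℝ => U.R (x 0)) '' U.D := by
    rintro ⟨x, hx, e⟩
    exact hU.R_ne_zero x hx e
  obtain ⟨p, hp⟩ := hU.isConnected.nonempty
  rcases lt_or_gt_of_ne (hU.R_ne_zero p hp) with hlt | hgt
  · refine ⟨-1, by norm_num, fun x hx => ?_⟩
    by_contra hcon
    exact h0 (hpre.ordConnected.out ⟨p, hp, rfl⟩ ⟨x, hx, rfl⟩ ⟨hlt.le, by simpa using hcon⟩)
  · refine ⟨1, by norm_num, fun x hx => ?_⟩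
    by_contra hcon
    exact h0 (hpre.ordConnected.out ⟨x, hx, rfl⟩ ⟨p, hp, rfl⟩ ⟨by simpa using hcon, hgt.le⟩)

theorem exists_scheme_of_deriv_b_eq_zero (hb : ∀ x ∈ U.D, deriv U.b (x 0) = 0) :
    ∃ Q : ThermoQuantities, U.HasScheme Q ∧ U.ThermalConductivityCompatible Q ∧
      ∀ x ∈ U.D, 0 < Q.n x ∧ 0 < Q.Θ x := by
  obtain ⟨σ, hσ, hpos⟩ := hU.exists_sign_R
  have hσ0 : σ ≠ 0 := by
    rintro rfl
    norm_num at hσ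
  have hR : ∀ x ∈ U.D, ContDiffAt ℝ ∞ (fun y : Fin 4 → ℝ => U.R (y 0)) x := fun x hx =>
    (hU.smooth_R x hx).comp_coord 0
  have hR3 : ∀ x ∈ U.D, ContDiffAt ℝ ∞ (fun y : Fin 4 → ℝ => σ * U.R (y 0) ^ 3) x :=
    fun x hx => contDiffAt_const.mul ((hR x hx).pow 3)
  have hR3d := fun x hx => (hR3 x hx).differentiableAt (by simp)
  have hpos3 : ∀ x ∈ U.D, 0 < σ * U.R (x 0) ^ 3 := fun x hx => by
    have e : σ * U.R (x 0) ^ 3 = (σ * U.R (x 0)) ^ 3 := by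
      linear_combination (- σ * U.R (x 0) ^ 3) * hσ
    rw [e]
    exact pow_pos (hpos x hx) 3
  have hne3 := fun x hx => (hpos3 x hx).ne'
  have hρ : ∀ x ∈ U.D, ContDiffAt ℝ ∞ U.ρ x := fun x hx =>
    (hU.contDiffAt_rhoOfTime hx).comp_coord 0
  have hpd : ∀ x ∈ U.D, ∀ μ, pd μ (fun y : Fin 4 → ℝ => σ * U.R (y 0) ^ 3) x
      = if 0 = μ then 3 * σ * U.R (x 0) ^ 2 * deriv U.R (x 0) else 0 := fun x hx μ => by
    have hd := hU.differentiableAt_R hx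
    rw [pd_const_mul μ σ (((hR x hx).pow 3).differentiableAt (by simp)),
      pd_comp_coord μ (φ := fun t => U.R t ^ 3) 0 (hd.pow 3)]
    have : deriv (fun t => U.R t ^ 3) (x 0) = 3 * U.R (x 0) ^ 2 * deriv U.R (x 0) := by
      simpa using (hd.hasDerivAt.fun_pow 3).deriv
    rw [this]
    split_ifs <;> ring
  -- With `s` and `Θ` constant, the first law reduces to `d(ρ/n) + p d(1/n) = 0`, which is energy
  -- conservation for `n ∝ R⁻³`; `ε` is forced by `ρ = n (1 + ε)`.
  refine ⟨⟨fun x => (σ * U.R (x 0) ^ 3)⁻¹, fun x => U.ρ x * (σ * U.R (x 0) ^ 3) - 1,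
    fun _ => 0, fun _ => 1⟩, ⟨?_, ?_, contDiffOn_const, contDiffOn_const, ?_, ?_, ?_, ?_⟩,
    fun x hx => ⟨one_ne_zero, fun μ => ?_⟩, fun x hx => ⟨inv_pos.2 (hpos3 x hx), one_pos⟩⟩
  · exact fun x hx => ((hR3 x hx).inv (hne3 x hx)).contDiffWithinAt
  · exact fun x hx => (((hρ x hx).mul (hR3 x hx)).sub contDiffAt_const).contDiffWithinAt
  · exact fun x hx => inv_ne_zero (hne3 x hx)
  · intro x hx
    rw [hU.expansion_eq hx, U.velocity_eq_lapseVelocity, along_lapse, hU.α_eq_one hb hx,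
      pd_inv 0 (f := fun y : Fin 4 → ℝ => σ * U.R (y 0) ^ 3) (hR3d x hx) (hne3 x hx),
      hpd x hx]
    have hR0 := hU.R_ne_zero x hx
    simp only [if_true]
    field_simp
    ring
  · intro x hx
    have hR0 := hU.R_ne_zero x hx
    simp only
    field_simp
    ring
  · intro x hx μ
    have hR0 := hU.R_ne_zero x hx
    have hR1 := hU.deriv_R_ne_zero x hx
    simp only [one_div, inv_inv]
    rw [pd_const, pd_sub μ (((hρ x hx).mul (hR3 x hx)).differentiableAt (by simp))
      (differentiableAt_const _), pd_const, pd_mul μ ((hρ x hx).differentiableAt (by simp))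
      (hR3d x hx), hpd x hx, hU.pd_ρ hx, StephaniData.p, hU.α_eq_one hb hx]
    split_ifs
    · field_simp
      ring
    · ring
  · rw [hU.acceleration_eq hx, hU.pd_eq_zero_of_α_eq_one hb hx, U.metric_eq_lapseMetric,
      U.velocity_eq_lapseVelocity, perpGrad_lapse (hU.α_ne_zero x hx)]
    simp [pd_const]

end IsThermodynamicStephani

namespace IsThermodynamicStephani

variable {U : StephaniData} (hU : IsThermodynamicStephani U) {Q : ThermoQuantities}

/-! ### Thermodynamic schemes compatible with a non-vanishing thermal conductivity -/

/-- The time function `α (ρ + p) = - (R / 3) dρ/dR`. -/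
noncomputable def enthalpyOfTime (U : StephaniData) (t : ℝ) : ℝ :=
  - (U.R t / 3 * (deriv U.rhoOfTime t / deriv U.R t))

include hU

theorem α_mul_enthalpy {x : Fin 4 → ℝ} (hx : x ∈ U.D) :
    U.α x * (U.ρ x + U.p x) = enthalpyOfTime U (x 0) := by
  have h := hU.α_ne_zero x hx
  rw [StephaniData.p, enthalpyOfTime]
  field_simp
  ring

section Scheme

variable (hQ : U.HasScheme Q) {x : Fin 4 → ℝ} (hx : x ∈ U.D)

include hQ hx

omit hQ in
theorem differentiableAt_of_contDiffOn {f : (Fin 4 → ℝ) → ℝ} (hf : ContDiffOn ℝ ∞ f U.D) :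
    DifferentiableAt ℝ f x :=
  (hf.contDiffAt (hU.isOpen.mem_nhds hx)).differentiableAt (by simp)

theorem pd_zero_n : pd 0 Q.n x = - (3 * Q.n x * U.α x * deriv U.R (x 0) / U.R (x 0)) := by
  have h := hQ.matter_conservation x hx
  rw [hU.expansion_eq hx, U.velocity_eq_lapseVelocity, along_lapse] at h
  have h1 := hU.α_ne_zero x hx
  have h2 := hU.R_ne_zero x hx
  field_simp at h ⊢
  linear_combination h

theorem pd_ε (μ : Fin 4) : pd μ Q.ε x
    = U.ρ x * pd μ (fun y => 1 / Q.n y) x + 1 / Q.n x * pd μ U.ρ x := by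
  have hn := hU.differentiableAt_of_contDiffOn hx hQ.smooth_n
  have hn0 := hQ.n_ne_zero x hx
  have hρ : DifferentiableAt ℝ U.ρ x :=
    ((hU.contDiffAt_rhoOfTime hx).comp_coord 0).differentiableAt (by simp)
  have hν : DifferentiableAt ℝ (fun y => 1 / Q.n y) x := by fun_prop (disch := exact hn0)
  have hev : Q.ε =ᶠ[nhds x] fun y => U.ρ y * (1 / Q.n y) - 1 := by
    filter_upwards [hU.isOpen.mem_nhds hx] with y hy
    have := hQ.n_ne_zero y hy
    rw [hQ.energy_decomposition y hy]
    field_simp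
    ring
  rw [pd_congr μ hev, pd_sub μ (hρ.fun_mul hν) (differentiableAt_const _), pd_const,
    pd_mul μ hρ hν, sub_zero]

theorem temperature_mul_pd_s (μ : Fin 4) : Q.Θ x * pd μ Q.s x
    = (U.ρ x + U.p x) * pd μ (fun y => 1 / Q.n y) x + 1 / Q.n x * pd μ U.ρ x := by
  rw [hQ.first_law x hx μ, hU.pd_ε hQ hx]
  ring

/-- Energy conservation, built into the definition of `p`, combines with matter conservation to make
the time component of `Θ ds` vanish. -/
theorem pd_zero_s (hΘ : Q.Θ x ≠ 0) : pd 0 Q.s x = 0 := by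
  have hn := hU.differentiableAt_of_contDiffOn hx hQ.smooth_n
  have hn0 := hQ.n_ne_zero x hx
  have h1 := hU.α_ne_zero x hx
  have h2 := hU.R_ne_zero x hx
  have h3 := hU.deriv_R_ne_zero x hx
  have h := hU.temperature_mul_pd_s hQ hx 0
  have e := hU.α_mul_enthalpy hx
  simp only [one_div] at h
  rw [pd_inv 0 hn hn0, hU.pd_zero_n hQ hx, hU.pd_ρ hx, if_pos rfl] at h
  rw [enthalpyOfTime] at e
  have h0 : Q.Θ x * pd 0 Q.s x = 0 := by
    rw [h]
    field_simp at e ⊢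
    linear_combination e
  exact (mul_eq_zero.1 h0).resolve_left hΘ

/-- Both `1/n` and `Ω³` grow at the logarithmic rate `3αṘ/R`. -/
theorem pd_zero_n_mul_volume : pd 0 (fun y => Q.n y * U.Ω y ^ 3) x = 0 := by
  have hn := hU.differentiableAt_of_contDiffOn hx hQ.smooth_n
  have hΩ := hU.differentiableAt_Ω hx
  have h2 := hU.R_ne_zero x hx
  have h3 : pd 0 (fun y => U.Ω y ^ 3) x = 3 * U.Ω x ^ 2 * pd 0 U.Ω x := by
    rw [pd_comp 0 (φ := fun r => r ^ 3) (by fun_prop) hΩ]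
    simp
  rw [pd_mul 0 hn (hΩ.fun_pow 3), h3, hU.pd_zero_n hQ hx, hU.pd_zero_Ω hx]
  field_simp
  ring

/-- The acceleration is the spatial gradient of `ln |α|`, so the Fourier constraint says that `ln
|αΘ|` has no spatial gradient. -/
theorem pd_three_α_mul_temperature (hC : U.ThermalConductivityCompatible Q) :
    pd 3 (fun y => U.α y * Q.Θ y) x = 0 := by
  obtain ⟨hΘ, ha⟩ := hC x hx
  have h1 := hU.α_ne_zero x hx
  have hd := hU.differentiableAt_of_contDiffOn hx hQ.smooth_Θ
  have h := ha 3
  rw [hU.acceleration_eq hx, U.metric_eq_lapseMetric, U.velocity_eq_lapseVelocity,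
    perpGrad_lapse h1, if_neg (by decide), if_neg (by decide), pd_log 3 hd hΘ] at h
  rw [pd_mul 3 (hU.differentiableAt_α hx) hd]
  field_simp at h
  linear_combination h

theorem pd_three_s : U.α x * Q.Θ x * pd 3 Q.s x
    = enthalpyOfTime U (x 0) * pd 3 (fun y => 1 / Q.n y) x := by
  rw [mul_assoc, hU.temperature_mul_pd_s hQ hx, hU.pd_ρ hx, if_neg (by decide),
    ← hU.α_mul_enthalpy hx]
  ring

end Scheme

theorem deriv_b_eq_zero_of_thermalConductivityCompatible
    (hρp : ∀ x ∈ U.D, U.ρ x + U.p x ≠ 0) (hQ : U.HasScheme Q)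
    (hC : U.ThermalConductivityCompatible Q) {p : Fin 4 → ℝ} (hp : p ∈ U.D) :
    deriv U.b (p 0) = 0 := by
  by_contra hd
  obtain ⟨r, hr, hbox⟩ := exists_box_subset hU.isOpen hp
  set I := Metric.ball (p 0) r
  set Z := Metric.ball (p 3) r
  have ht₀ : p 0 ∈ I := Metric.mem_ball_self hr
  have hz₀ : p 3 ∈ Z := Metric.mem_ball_self hr
  have hs : ∀ t ∈ I, ∀ z ∈ Z, Q.s (planeEvent p t z) = Q.s (planeEvent p (p 0) z) := by
    intro t ht z hz
    refine eq_on_ball_of_hasDerivAt_zero (f := fun v => Q.s (planeEvent p v z)) (fun v hv => ?_)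
      ht ht₀
    have hx := hbox v hv z hz
    rw [← hU.pd_zero_s hQ hx (hC _ hx).1]
    exact hasDerivAt_comp_of_single 0 (hasDerivAt_planeEvent_left p v z)
      (hU.differentiableAt_of_contDiffOn hx hQ.smooth_s)
  have hnΩ : ∀ t ∈ I, ∀ z ∈ Z, Q.n (planeEvent p t z) * U.Ω (planeEvent p t z) ^ 3
      = Q.n (planeEvent p (p 0) z) * U.Ω (planeEvent p (p 0) z) ^ 3 := by
    intro t ht z hz
    refine eq_on_ball_of_hasDerivAt_zero
      (f := fun v => Q.n (planeEvent p v z) * U.Ω (planeEvent p v z) ^ 3) (fun v hv => ?_) ht ht₀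
    have hx := hbox v hv z hz
    rw [← hU.pd_zero_n_mul_volume hQ hx]
    exact hasDerivAt_comp_of_single (f := fun y => Q.n y * U.Ω y ^ 3) 0
      (hasDerivAt_planeEvent_left p v z)
      ((hU.differentiableAt_of_contDiffOn hx hQ.smooth_n).mul ((hU.differentiableAt_Ω hx).pow 3))
  have hαΘ : ∀ t ∈ I, ∀ z ∈ Z, U.α (planeEvent p t z) * Q.Θ (planeEvent p t z)
      = U.α (planeEvent p t (p 3)) * Q.Θ (planeEvent p t (p 3)) := by
    intro t ht z hz
    refine eq_on_ball_of_hasDerivAt_zero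
      (f := fun v => U.α (planeEvent p t v) * Q.Θ (planeEvent p t v)) (fun v hv => ?_) hz hz₀
    have hx := hbox t ht v hv
    rw [← hU.pd_three_α_mul_temperature hQ hx hC]
    exact hasDerivAt_comp_of_single (f := fun y => U.α y * Q.Θ y) 3
      (hasDerivAt_planeEvent_right p t v)
      ((hU.differentiableAt_α hx).mul (hU.differentiableAt_of_contDiffOn hx hQ.smooth_Θ))
  have hf0 : ∀ t ∈ I, U.α (planeEvent p t (p 3)) * Q.Θ (planeEvent p t (p 3)) ≠ 0 := fun t ht =>
    mul_ne_zero (hU.α_ne_zero _ (hbox t ht _ hz₀)) (hC _ (hbox t ht _ hz₀)).1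
  -- This is `(ρ + p)/Θ`, written as a quotient of `α(ρ + p)` by `αΘ`, each independent of `z` in
  -- the box.
  let c : ℝ → ℝ := fun t => enthalpyOfTime U t
    / (U.α (planeEvent p t (p 3)) * Q.Θ (planeEvent p t (p 3)))
  have hc0 : ∀ t ∈ I, c t ≠ 0 := fun t ht => by
    have hx := hbox t ht _ hz₀
    refine div_ne_zero ?_ (hf0 t ht)
    have e := hU.α_mul_enthalpy hx
    rw [planeEvent_zero] at e
    rw [← e]
    exact mul_ne_zero (hU.α_ne_zero _ hx) (hρp _ hx)
  have hsep : ∀ t ∈ I, ∀ z ∈ Z,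
      Q.s (planeEvent p t z) - c t * (1 / Q.n (planeEvent p t z))
        = Q.s (planeEvent p t (p 3)) - c t * (1 / Q.n (planeEvent p t (p 3))) := by
    intro t ht z hz
    refine eq_on_ball_of_hasDerivAt_zero
      (f := fun v => Q.s (planeEvent p t v) - c t * (1 / Q.n (planeEvent p t v)))
      (fun v hv => ?_) hz hz₀
    have hx := hbox t ht v hv
    have h1 := hasDerivAt_comp_of_single 3 (hasDerivAt_planeEvent_right p t v)
      (hU.differentiableAt_of_contDiffOn hx hQ.smooth_s)
    have h2 := hasDerivAt_comp_of_single (f := fun y => 1 / Q.n y) 3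
      (hasDerivAt_planeEvent_right p t v)
      (by
        have hn := hU.differentiableAt_of_contDiffOn hx hQ.smooth_n
        fun_prop (disch := exact hQ.n_ne_zero _ hx))
    have e := hU.pd_three_s hQ hx
    rw [hαΘ t ht v hv, planeEvent_zero] at e
    have e' : pd 3 Q.s (planeEvent p t v)
        - c t * pd 3 (fun y => 1 / Q.n y) (planeEvent p t v) = 0 := by
      have := hf0 t ht
      simp only [c]
      rw [div_mul_eq_mul_div, ← e, mul_div_cancel_left₀ _ this, sub_self]
    rw [← e']
    exact h1.sub (h2.const_mul (c t))
  -- Both `n Ω³` and `q` are static, and `Ω q = R/(1 + b w)`; hence `1/n = R³ M/(1 + b w)³` at all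
  -- times in the box.
  let M : ℝ → ℝ := fun z => 1 / (Q.n (planeEvent p (p 0) z) * U.Ω (planeEvent p (p 0) z) ^ 3
    * U.q (planeEvent p (p 0) z) ^ 3)
  have hM0 : ∀ z ∈ Z, M z ≠ 0 := fun z hz => by
    have hx := hbox _ ht₀ z hz
    exact one_div_ne_zero (mul_ne_zero (mul_ne_zero (hQ.n_ne_zero _ hx)
      (pow_ne_zero 3 (hU.Ω_ne_zero hx))) (pow_ne_zero 3 (hU.q_ne_zero _ hx)))
  have hrel : ∀ t ∈ I, ∀ z ∈ Z, Q.s (planeEvent p (p 0) z)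
      - (c t * U.R t ^ 3) * M z / (1 + U.b t * U.w (planeEvent p (p 0) z)) ^ 3
        = Q.s (planeEvent p t (p 3)) - c t * (1 / Q.n (planeEvent p t (p 3))) := by
    intro t ht z hz
    have hx := hbox t ht z hz
    have hn := hQ.n_ne_zero _ hx
    have hq := hU.q_ne_zero _ hx
    have hR := hU.R_ne_zero _ hx
    have hbw := hU.one_add_bw_ne_zero _ hx
    have hqeq : U.q (planeEvent p (p 0) z) = U.q (planeEvent p t z) := by
      rw [U.q_planeEvent, U.q_planeEvent]
    rw [← hsep t ht z hz, hs t ht z hz]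
    simp only [M]
    rw [← hnΩ t ht z hz, hqeq, U.w_planeEvent_eq p (p 0) t z, StephaniData.Ω, StephaniData.L]
    simp only [planeEvent_zero] at hR hbw ⊢
    field_simp
  have hbw : ∀ t ∈ I, ∀ z ∈ Z, 1 + U.b t * U.w (planeEvent p (p 0) z) ≠ 0 := fun t ht z hz => by
    rw [U.w_planeEvent_eq p (p 0) t z]
    exact hU.one_add_bw_ne_zero _ (hbox t ht z hz)
  have hcR : ∀ t ∈ I, c t * U.R t ^ 3 ≠ 0 := fun t ht =>
    mul_ne_zero (hc0 t ht) (pow_ne_zero 3 (hU.R_ne_zero _ (hbox t ht _ hz₀)))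
  -- Three times are needed to eliminate both unknown functions `s` and `M`; non-zero values of `b`
  -- ensure that each `1 + b w` has a root in `w`.
  obtain ⟨t₁, m₁, t₂, m₂, t₃, m₃, b₁, b₂, b₃, b₁₂, b₁₃, b₂₃⟩ :=
    exists_three_values (Metric.ball_mem_nhds (p 0) hr) (hU.differentiableAt_b hp).hasDerivAt hd
  exact not_separated_of_infinite
    (StephaniData.infinite_image_w (U := U) (p := p) (t := p 0) hr
      fun z hz => hU.q_ne_zero _ (hbox _ ht₀ z hz))
    b₁ b₃ b₁₂ b₁₃ b₂₃ (hbw t₁ m₁) (hbw t₂ m₂) (hbw t₃ m₃) hM0 (hcR t₁ m₁) (hcR t₃ m₃)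
    (hrel t₁ m₁) (hrel t₂ m₂) (hrel t₃ m₃)

end IsThermodynamicStephani

theorem mainTheorem10 (U : StephaniData) (hU : IsThermodynamicStephani U) :
    U.ShearViscosityCompatible ∧
    ((∀ x ∈ U.D, U.ρ x + U.p x ≠ 0) →
      ((∃ Q : ThermoQuantities, U.HasScheme Q ∧ U.ThermalConductivityCompatible Q) ↔
        IsFLRW U.D U.metric)) ∧
    (IsFLRW U.D U.metric →
      ∃ Q : ThermoQuantities, U.HasScheme Q ∧ U.ThermalConductivityCompatible Q ∧
        ∀ x ∈ U.D, 0 < Q.n x ∧ 0 < Q.Θ x) := by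
  have hscheme := fun h : IsFLRW U.D U.metric =>
    hU.exists_scheme_of_deriv_b_eq_zero fun _ hx => hU.deriv_b_eq_zero_of_isFLRW h hx
  refine ⟨hU.shearViscosityCompatible, fun hρp => ⟨?_, fun h => ?_⟩, hscheme⟩
  · rintro ⟨Q, hQ, hC⟩
    exact hU.isFLRW_of_deriv_b_eq_zero fun _ hx =>
      hU.deriv_b_eq_zero_of_thermalConductivityCompatible hρp hQ hC hx
  · obtain ⟨Q, hQ, hC, -⟩ := hscheme h
    exact ⟨Q, hQ, hC⟩
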